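/- Let $t$ and $x$ be indeterminates. For a permutation $\pi$ of $[n]=\{1,\dots,n\}$ let $\mathrm{exc}(\pi)=\#\{i\in[n] : i<\pi(i)\}$ be its number of excedances, let $\mathfrak{D}_n$ be the set of derangements (permutations without fixed points) of $[n]$, put $D_n(t)=\sum_{\pi\in\mathfrak{D}_n}t^{\mathrm{exc}(\pi)}$, and let $$D(t;x)=1+\sum_{n\ge1}D_n(t)\frac{x^n}{n!}.$$ Define polynomials $U_n(s,t)$ by $U_0(s,t)=1$, $U_1(s,t)=2t$ and $U_n(s,t)=2t\,U_{n-1}(s,t)-s\,U_{n-2}(s,t)$ for $n\ge2$, and let $$V(s,t;x)=\sum_{n\ge0}U_n(s,t)\frac{x^{n+2}}{(n+2)!}.$$ Then, as formal power series in $x$ with coefficients in $\mathbb{Q}[t]$, $$D(t;x)=\frac{1}{1-t\,V\bigl(t,\tfrac{1+t}{2};x\bigr)}$$ (equivalently, this identity holds for every element $t$ of every commutative $\mathbb{Q}$-algebra). In particular, $D(-1;x)=F(x)^{-1}$, where $F(x)=\sum_{n\ge0}f_n\frac{x^n}{n!}$ with $f_n=(n+1)\bmod 2$, that is, $F(x)=1+\frac{x^2}{2!}+\frac{x^4}{4!}+\cdots=\cosh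 x=\frac{e^{x}+e^{-x}}{2}$; hence $D(-1;x)=\frac{1}{\cosh x}$. -/

import Mathlib

open PowerSeries
open scoped Nat

/-- The number of excedances of `π`, i.e. of indices `i` with `i < π i`. -/
def exc {n : ℕ} (π : Equiv.Perm (Fin n)) : ℕ :=
  (Finset.univ.filter fun i => i < π i).card

/-- The excedance polynomial over derangements,
`D_n(t) = ∑ t ^ exc π` (sum over all derangements `π` of an `n`-element set), at an element `t`
of a commutative ring; the polynomial itself is the case `t = X` in `ℚ[X]`. -/
def excPoly {R : Type*} [CommRing R] (t : R) (n : ℕ) : R :=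
  ∑ π ∈ Finset.univ.filter (fun π : Equiv.Perm (Fin n) => π ∈ derangements (Fin n)), t ^ exc π

/-- `D(t;x) = 1 + ∑_{n ≥ 1} D_n(t) x ^ n / n!`, a formal power series in `x`. -/
noncomputable def excEgf {R : Type*} [CommRing R] [Algebra ℚ R] (t : R) : R⟦X⟧ :=
  1 + PowerSeries.mk fun n => if n = 0 then 0 else (1 / (n ! : ℚ)) • excPoly t n

/-- The two-parameter Chebyshev polynomials of the second kind `U_n(s,t)`:
`U_0 = 1`, `U_1 = 2t`, `U_n = 2t U_{n-1} - s U_{n-2}` for `n ≥ 2`. -/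
def chebU {R : Type*} [CommRing R] (s t : R) : ℕ → R
  | 0 => 1
  | 1 => 2 * t
  | n + 2 => 2 * t * chebU s t (n + 1) - s * chebU s t n

/-- `V(s,t;x) = ∑_{n ≥ 0} U_n(s,t) x ^ (n+2) / (n+2)!`, a formal power series in `x`;
the coefficient of `x ^ m` is `U_{m-2}(s,t) / m!` for `m ≥ 2` and `0` for `m < 2`. -/
noncomputable def chebV {R : Type*} [CommRing R] [Algebra ℚ R] (s t : R) : R⟦X⟧ :=
  PowerSeries.mk fun m => if m < 2 then 0 else (1 / (m ! : ℚ)) • chebU s t (m - 2)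

/-- `F(x) = ∑_{n ≥ 0} f_n x ^ n / n!` with `f_n = (n + 1) mod 2`, i.e. `1 + x^2/2! + x^4/4! + ⋯`. -/
noncomputable def seriesF : ℚ⟦X⟧ :=
  PowerSeries.mk fun n => (((n + 1) % 2 : ℕ) : ℚ) / (n ! : ℚ)

/-- The formal power series `cosh x = (e ^ x + e ^ (-x)) / 2`. -/
noncomputable def coshSeries : ℚ⟦X⟧ :=
  (1 / 2 : ℚ) • (PowerSeries.exp ℚ + PowerSeries.evalNegHom (PowerSeries.exp ℚ))

/-! Sorting permutations by support gives `∑ π, y ^ fix π * t ^ exc π = ∑ k, n.choose k • (y ^ (n -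
k) * excPoly t k)`, where `fix π` counts fixed points. At `y = t` the left side counts weak
excedances, at `y = 1` excedances; for `n ≥ 1` the cyclic shift shows that the former is `t` times
the latter. Hence `∑ k, n.choose k • ((t ^ (n - k) - t) * excPoly t k) = 0`. Dividing by `1 - t`
leaves the coefficients `geomCoeff`, and since `U_n(t,(1+t)/2) = 1 + t + ⋯ + t ^ n` these are those
of `1 - t V`. The sums are then the positive-degree coefficients of `D (1 - t V)`. -/

open Finset in
theorem exc_extendDomain {n k : ℕ} {s : Finset (Fin n)} (e : Fin k ≃o s)
    (σ : Equiv.Perm (Fin k)) : exc (σ.extendDomain e.toEquiv) = exc σ := by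
  unfold exc
  rw [← card_map (e.toEquiv.toEmbedding.trans (Function.Embedding.subtype _))]
  congr 1
  ext i
  simp only [mem_filter, mem_univ, true_and, mem_map, Function.Embedding.trans_apply,
    Function.Embedding.subtype_apply, Equiv.coe_toEmbedding]
  constructor
  · intro h
    by_cases hi : i ∈ s
    · obtain ⟨j, hj⟩ := e.surjective ⟨i, hi⟩
      have hij : i = ((e.toEquiv j : s) : Fin n) := (congrArg Subtype.val hj).symm
      refine ⟨j, ?_, hij.symm⟩
      rw [hij, Equiv.Perm.extendDomain_apply_image] at h
      exact e.lt_iff_lt.1 h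
    · rw [Equiv.Perm.extendDomain_apply_not_subtype _ _ hi] at h
      exact absurd h (lt_irrefl _)
  · rintro ⟨j, hj, rfl⟩
    rw [Equiv.Perm.extendDomain_apply_image]
    exact e.lt_iff_lt.2 hj

theorem exists_extendDomain_eq {α β : Type*} [Fintype α] [DecidableEq α] {s : Finset α}
    (e : β ≃ s) {π : Equiv.Perm α} (h : π.support = s) :
    ∃ σ : Equiv.Perm β, σ.extendDomain e = π := by
  have hs : ∀ x, π x ∈ s ↔ x ∈ s := fun x => by rw [← h, Equiv.Perm.apply_mem_support]
  refine ⟨(e.trans (π.subtypePerm hs)).trans e.symm, ?_⟩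
  ext i
  by_cases hi : i ∈ s
  · rw [Equiv.Perm.extendDomain_apply_subtype _ _ hi]
    simp
  · rw [Equiv.Perm.extendDomain_apply_not_subtype _ _ hi]
    rw [← h, Equiv.Perm.notMem_support] at hi
    exact hi.symm

open Finset in
theorem support_extendDomain_eq_iff {α β : Type*} [Fintype α] [DecidableEq α] [Fintype β]
    [DecidableEq β] {s : Finset α} (e : β ≃ s) (σ : Equiv.Perm β) :
    (σ.extendDomain e).support = s ↔ σ ∈ derangements β := by
  constructor
  · intro h b hb
    have hb' : ((e b : s) : α) ∈ (σ.extendDomain e).support := by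
      rw [h]
      exact (e b).2
    rw [Equiv.Perm.mem_support, Equiv.Perm.extendDomain_apply_image, hb] at hb'
    exact hb' rfl
  · intro h
    ext i
    rw [Equiv.Perm.mem_support]
    by_cases hi : i ∈ s
    · obtain ⟨b, hb⟩ := e.surjective ⟨i, hi⟩
      have hib : i = ((e b : s) : α) := (congrArg Subtype.val hb).symm
      rw [hib, Equiv.Perm.extendDomain_apply_image]
      simpa [Subtype.val_inj] using h b
    · simp [Equiv.Perm.extendDomain_apply_not_subtype _ _ hi, hi]

open Finset in
/-- The permutations with a prescribed support are enumerated by excedances like the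
derangements of a set of that size. -/
theorem sum_exc_support_eq {R : Type*} [CommRing R] (t : R) {n : ℕ} (s : Finset (Fin n)) :
    ∑ π ∈ univ.filter (fun π : Equiv.Perm (Fin n) => π.support = s), t ^ exc π =
      excPoly t #s := by
  -- The enumeration must be increasing, because `exc` depends on the order.
  set e : Fin #s ≃o s := s.orderIsoOfFin rfl
  unfold excPoly
  symm
  refine sum_bij (fun σ _ => σ.extendDomain e.toEquiv) ?_ ?_ ?_ ?_
  · intro σ hσ
    exact mem_filter.2 ⟨mem_univ _, (support_extendDomain_eq_iff _ _).2 (mem_filter.1 hσ).2⟩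
  · intro σ _ τ _ h
    exact Equiv.Perm.extendDomainHom_injective e.toEquiv h
  · intro π hπ
    rw [mem_filter] at hπ
    obtain ⟨σ, rfl⟩ := exists_extendDomain_eq e.toEquiv hπ.2
    exact ⟨σ, mem_filter.2 ⟨mem_univ _, (support_extendDomain_eq_iff _ _).1 hπ.2⟩, rfl⟩
  · intro σ _
    rw [exc_extendDomain]

open Finset in
/-- The joint enumeration of all permutations by fixed points and excedances. -/
theorem sum_fixedPoints_exc {R : Type*} [CommRing R] (y t : R) (n : ℕ) :
    ∑ π : Equiv.Perm (Fin n), y ^ (n - #π.support) * t ^ exc π =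
      ∑ k ∈ range (n + 1), n.choose k • (y ^ (n - k) * excPoly t k) := by
  have h := sum_powerset_apply_card (fun k => y ^ (n - k) * excPoly t k)
    (x := (univ : Finset (Fin n)))
  rw [card_univ, Fintype.card_fin] at h
  rw [← h, powerset_univ, ← sum_fiberwise (univ : Finset (Equiv.Perm (Fin n)))
    (fun π => π.support)]
  refine sum_congr rfl fun s _ => ?_
  rw [← sum_exc_support_eq, mul_sum]
  refine sum_congr rfl fun π hπ => ?_
  rw [(mem_filter.1 hπ).2]

open Finset in
theorem card_weakExc {n : ℕ} (π : Equiv.Perm (Fin n)) :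
    #(univ.filter fun i => i ≤ π i) = n - #π.support + exc π := by
  have hfix : n - #π.support = #(univ.filter fun i => π i = i) := by
    have : (univ.filter fun i => π i = i) = π.supportᶜ := by
      ext i; simp
    rw [this, card_compl, Fintype.card_fin]
  rw [hfix, exc, ← card_union_of_disjoint]
  · congr 1
    ext i
    simp only [mem_filter, mem_univ, true_and, mem_union]
    rw [le_iff_eq_or_lt, eq_comm]
  · rw [disjoint_filter]
    intro i _ h1 h2
    exact h2.ne h1.symm

open Finset in
/-- Composing with the cyclic shift turns weak excedances into excedances, but for one. -/
theorem card_weakExc_eq_exc_rotate {n : ℕ} (π : Equiv.Perm (Fin (n + 1))) :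
    #(univ.filter fun i => i ≤ π i) = exc (finRotate (n + 1) * π) + 1 := by
  -- The index sent to the last element is always a weak excedance, but the shift sends its value to
  -- `0`; this is the one lost. Elsewhere the shift adds `1`, turning `≤` into `<`.
  have hmem : π.symm (Fin.last n) ∉
      univ.filter fun i => i < (finRotate (n + 1) * π) i := by
    simp
  rw [exc, ← card_insert_of_notMem hmem]
  congr 1
  ext i
  simp only [mem_filter, mem_univ, true_and, mem_insert]
  rcases eq_or_ne (π i) (Fin.last n) with h | h
  · have h1 : i = π.symm (Fin.last n) := by rw [← h, Equiv.symm_apply_apply]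
    rw [h]
    exact iff_of_true (Fin.le_last i) (Or.inl h1)
  · have h1 : i ≠ π.symm (Fin.last n) := fun hi => h (by simp [hi])
    have h2 : ((finRotate (n + 1) (π i) : Fin (n + 1)) : ℕ) = π i + 1 :=
      coe_finRotate_of_ne_last h
    rw [or_iff_right h1, Equiv.Perm.mul_apply, Fin.le_def, Fin.lt_def, h2, Nat.lt_succ_iff]

-- Left multiplication by the shift permutes the group, so the sum can be reindexed. The set must be
-- nonempty: on `Fin 0` the two sides would be `1` and `t`.
open Finset in
theorem sum_weakExc {R : Type*} [CommRing R] (t : R) (n : ℕ) :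
    ∑ π : Equiv.Perm (Fin (n + 1)), t ^ (n + 1 - #π.support) * t ^ exc π =
      t * ∑ π : Equiv.Perm (Fin (n + 1)), t ^ exc π := by
  rw [mul_sum, ← Equiv.sum_comp (Equiv.mulLeft (finRotate (n + 1))) fun π => t * t ^ exc π]
  refine sum_congr rfl fun π _ => ?_
  rw [← pow_add, ← card_weakExc, card_weakExc_eq_exc_rotate, Equiv.coe_mulLeft, pow_succ']

-- The difference of `sum_fixedPoints_exc` at `y = t` and `t` times its value at `y = 1`.
open Finset in
theorem sum_choose_excPoly_mul_sub {R : Type*} [CommRing R] (t : R) (n : ℕ) :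
    ∑ k ∈ range (n + 2), (n + 1).choose k • ((t ^ (n + 1 - k) - t) * excPoly t k) = 0 := by
  have h := sum_weakExc t n
  have h1 := sum_fixedPoints_exc 1 t (n + 1)
  simp only [one_pow, one_mul] at h1
  rw [sum_fixedPoints_exc, h1, mul_sum, ← sub_eq_zero, ← sum_sub_distrib] at h
  rw [← h]
  refine sum_congr rfl fun k _ => ?_
  simp only [nsmul_eq_mul]
  ring

/-- `n!` times the coefficient of `x ^ n` in `1 - t V(t,(1+t)/2;x)`. -/
def geomCoeff {R : Type*} [CommRing R] (t : R) : ℕ → R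
  | 0 => 1
  | n + 1 => -(t * ∑ i ∈ Finset.range n, t ^ i)

theorem one_sub_mul_geomCoeff {R : Type*} [CommRing R] (t : R) (n : ℕ) :
    (1 - t) * geomCoeff t n = t ^ n - t := by
  cases n with
  | zero => simp [geomCoeff]
  | succ n =>
    have := mul_neg_geom_sum t n
    simp only [geomCoeff]
    linear_combination (-t) * this

theorem map_geomCoeff {R S : Type*} [CommRing R] [CommRing S] (f : R →+* S) (t : R) (n : ℕ) :
    f (geomCoeff t n) = geomCoeff (f t) n := by
  cases n <;> simp [geomCoeff, map_sum]

theorem map_excPoly {R S : Type*} [CommRing R] [CommRing S] (f : R →+* S) (t : R) (n : ℕ) :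
    f (excPoly t n) = excPoly (f t) n := by
  simp [excPoly, map_sum]

open Finset in
theorem sum_choose_excPoly_mul_geomCoeff {R : Type*} [CommRing R] (t : R) (n : ℕ) :
    ∑ k ∈ range (n + 2), (n + 1).choose k • (geomCoeff t (n + 1 - k) * excPoly t k) = 0 := by
  -- In `R` the element `1 - t` may be a zero divisor, so the division is done for the indeterminate
  -- over `ℤ`, then specialised.
  have hX : ∑ k ∈ range (n + 2), (n + 1).choose k •
      (geomCoeff (Polynomial.X : Polynomial ℤ) (n + 1 - k) * excPoly Polynomial.X k) = 0 := by
    have hne : (1 - Polynomial.X : Polynomial ℤ) ≠ 0 := by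
      intro h
      simpa using congrArg (Polynomial.eval 0) h
    refine (mul_eq_zero.1 ?_).resolve_left hne
    rw [mul_sum, ← sum_choose_excPoly_mul_sub (Polynomial.X : Polynomial ℤ) n]
    refine sum_congr rfl fun k _ => ?_
    rw [mul_smul_comm, ← mul_assoc, one_sub_mul_geomCoeff]
  have h := congrArg (Polynomial.aeval t : Polynomial ℤ →ₐ[ℤ] R).toRingHom hX
  simp only [map_sum, map_nsmul, map_mul, map_geomCoeff, map_excPoly, map_zero] at h
  simpa only [AlgHom.toRingHom_eq_coe, RingHom.coe_coe, Polynomial.aeval_X] using h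

/-- Here the recurrence has characteristic polynomial `z ^ 2 - (1 + t) z + t = (z - 1)(z - t)`. -/
theorem chebU_eq_geom_sum {R : Type*} [CommRing R] [Algebra ℚ R] (t : R) (n : ℕ) :
    chebU t ((1 / 2 : ℚ) • (1 + t)) n = ∑ i ∈ Finset.range (n + 1), t ^ i := by
  have h2 : 2 * ((1 / 2 : ℚ) • (1 + t)) = 1 + t := by
    rw [two_mul, ← add_smul]
    norm_num
  induction n using Nat.twoStepInduction with
  | zero => simp [chebU]
  | one => rw [chebU, h2, Finset.sum_range_succ, Finset.sum_range_one, pow_zero, pow_one]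
  | more n ih0 ih1 =>
    rw [chebU, h2, ih0, ih1, Finset.sum_range_succ _ (n + 2), Finset.sum_range_succ _ (n + 1)]
    ring

theorem excPoly_zero {R : Type*} [CommRing R] (t : R) : excPoly t 0 = 1 := by
  have h : ∀ π : Equiv.Perm (Fin 0), π ∈ derangements (Fin 0) := fun π i => i.elim0
  simp [excPoly, exc, h]

theorem coeff_excEgf {R : Type*} [CommRing R] [Algebra ℚ R] (t : R) (n : ℕ) :
    coeff n (excEgf t) = (1 / (n ! : ℚ)) • excPoly t n := by
  rcases eq_or_ne n 0 with rfl | h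
  · simp [excEgf, excPoly_zero]
  · simp [excEgf, h, coeff_one]

theorem coeff_one_sub_chebV {R : Type*} [CommRing R] [Algebra ℚ R] (t : R) (n : ℕ) :
    coeff n (1 - t • chebV t ((1 / 2 : ℚ) • (1 + t))) = (1 / (n ! : ℚ)) • geomCoeff t n := by
  match n with
  | 0 => simp [chebV, geomCoeff]
  | 1 => simp [chebV, geomCoeff, coeff_one]
  | n + 2 =>
    rw [map_sub, coeff_smul, chebV, coeff_mk, if_neg (by omega), Nat.add_sub_cancel,
      chebU_eq_geom_sum, coeff_one, if_neg (by omega), geomCoeff, smul_neg, zero_sub,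
      smul_eq_mul, mul_smul_comm]

theorem excEgf_mul_one_sub_chebV {R : Type*} [CommRing R] [Algebra ℚ R] (t : R) :
    excEgf t * (1 - t • chebV t ((1 / 2 : ℚ) • (1 + t))) = 1 := by
  ext n
  rw [coeff_mul, coeff_one]
  simp only [coeff_excEgf, coeff_one_sub_chebV]
  rw [Finset.Nat.sum_antidiagonal_eq_sum_range_succ
    (fun i j => ((1 / (i ! : ℚ)) • excPoly t i) * ((1 / (j ! : ℚ)) • geomCoeff t j))]
  cases n with
  | zero => simp [excPoly_zero, geomCoeff]
  | succ n =>
    rw [if_neg (by omega), ← smul_zero (1 / ((n + 1)! : ℚ)),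
      ← sum_choose_excPoly_mul_geomCoeff t n, Finset.smul_sum]
    refine Finset.sum_congr rfl fun k hk => ?_
    have hk' : k ≤ n + 1 := by
      have := Finset.mem_range.1 hk
      omega
    rw [smul_mul_smul_comm, ← Nat.cast_smul_eq_nsmul ℚ, smul_smul, Nat.cast_choose ℚ hk',
      mul_comm (excPoly t k)]
    congr 1
    have : ((n + 1)! : ℚ) ≠ 0 := by positivity
    field_simp

theorem geomCoeff_neg_one (n : ℕ) : geomCoeff (-1 : ℚ) n = (((n + 1) % 2 : ℕ) : ℚ) := by
  -- At `t = -1` this reads `2 * geomCoeff (-1) n = (-1) ^ n + 1`.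
  have h := one_sub_mul_geomCoeff (-1 : ℚ) n
  rcases Nat.even_or_odd n with hn | hn
  · rw [hn.neg_one_pow] at h
    rw [Nat.odd_iff.1 hn.add_one]
    push_cast
    linarith
  · rw [hn.neg_one_pow] at h
    rw [Nat.even_iff.1 hn.add_one]
    push_cast
    linarith

theorem one_sub_chebV_neg_one :
    1 - (-1 : ℚ) • chebV (-1 : ℚ) ((1 / 2 : ℚ) • (1 + (-1))) = seriesF := by
  ext n
  rw [coeff_one_sub_chebV, geomCoeff_neg_one, seriesF, coeff_mk, smul_eq_mul]
  ring

theorem seriesF_eq_coshSeries : seriesF = coshSeries := by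
  ext n
  rw [seriesF, coshSeries, coeff_mk, coeff_smul, map_add, evalNegHom, coeff_rescale, coeff_exp]
  rcases Nat.even_or_odd n with hn | hn
  · rw [hn.neg_one_pow, Nat.odd_iff.1 hn.add_one]
    simp
    ring
  · rw [hn.neg_one_pow, Nat.even_iff.1 hn.add_one]
    simp

theorem excEgf_neg_one : excEgf (-1 : ℚ) = seriesF⁻¹ := by
  have hF : constantCoeff seriesF ≠ 0 := by
    rw [← coeff_zero_eq_constantCoeff_apply, seriesF, coeff_mk]
    simp
  rw [PowerSeries.eq_inv_iff_mul_eq_one hF, ← one_sub_chebV_neg_one]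
  exact excEgf_mul_one_sub_chebV (-1 : ℚ)

/-- Part one is `D(t;x) = 1 / (1 - t V(t,(1+t)/2;x))` for every element `t` of every commutative
`ℚ`-algebra (an indeterminate in `ℚ[X]`, in particular): the series `1 - t V(t,(1+t)/2;x)` is
invertible and `D(t;x)` is its inverse. Part two is `D(-1;x) = F(x)⁻¹`, where `F(x) = cosh x`. -/
theorem mainTheorem8 :
    (∀ (R : Type*) [CommRing R] [Algebra ℚ R] (t : R),
      excEgf t * (1 - t • chebV t ((1 / 2 : ℚ) • (1 + t))) = 1) ∧
    excEgf (-1 : ℚ) = seriesF⁻¹ ∧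
    seriesF = coshSeries ∧
    excEgf (-1 : ℚ) = coshSeries⁻¹ := by
  exact ⟨fun _ _ _ t => excEgf_mul_one_sub_chebV t, excEgf_neg_one, seriesF_eq_coshSeries,
    seriesF_eq_coshSeries ▸ excEgf_neg_one⟩
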